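/- Let $W=(W(t))_{t\in\mathbb R}$ be a standard two-sided Wiener process, let $H\in L_2(\mathbb R)$ be real-valued, and let $(g_\Delta)_{\Delta>0}$ be real-valued functions with $g_\Delta\in L_2(\mathbb R)$, $g_\Delta(t)=g_\Delta(-t)$ for all $t\in\mathbb R$, $\sup_{\Delta>0}\|g_\Delta^*\|_\infty<\infty$, and, for some $c\in(0,\infty)$ and every $a\in(0,\infty)$, $\lim_{\Delta\to\infty}\sup_{-a\le\lambda\le a}|g_\Delta^*(\lambda)-c|=0$, where $\varphi^*(\lambda)=\int_{-\infty}^{\infty}e^{-i\lambda t}\varphi(t)\,dt$ is the Fourier–Plancherel transform (a function defined almost everywhere, so suprema are essential suprema). Let $$Y(t)=\int_{-\infty}^{\infty}H(t-s)\,dW(s),\qquad X_\Delta(t)=\int_{-\infty}^{\infty}g_\Delta(t-s)\,dW(s),\qquad t\in\mathbb R,$$ be Wiener integrals, and assume that the processes $Y$ and $X_\Delta$, $\Delta>0$, have almost surely continuous sample paths. For $T>0$, $\Delta>0$ put $$\widehat H_{T,\Delta}(\tau)=\frac1{cT}\int_0^T Y(t+\tau)X_\Delta(t)\,dt,\qquad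 \tau\in\mathbb R.$$ Then, for all $T>0$, $\Delta>0$ and $\tau\in\mathbb R$, the random variable $\widehat H_{T,\Delta}(\tau)$ is square-integrable; and if $\operatorname{Var}\widehat H_{T,\Delta}(\tau)=\mathbf E|\widehat H_{T,\Delta}(\tau)-\mathbf E\widehat H_{T,\Delta}(\tau)|^2>0$, then for all $x>0$ $$\mathbf P\Big\{\widehat H_{T,\Delta}(\tau)-\mathbf E\widehat H_{T,\Delta}(\tau)\ge x\sqrt{\operatorname{Var}\widehat H_{T,\Delta}(\tau)}\Big\}\le K(x),$$ $$\mathbf P\Big\{\widehat H_{T,\Delta}(\tau)-\mathbf E\widehat H_{T,\Delta}(\tau)\le -x\sqrt{\operatorname{Var}\widehat H_{T,\Delta}(\tau)}\Big\}\le K(x),$$ $$\mathbf P\Big\{\big|\widehat H_{T,\Delta}(\tau)-\mathbf E\widehat H_{T,\Delta}(\tau)\big|\ge x\sqrt{\operatorname{Var}\widehat H_{T,\Delta}(\tau)}\Big\}\le 2K(x),$$ where $K(x)=(1+\sqrt2\,x)^{1/2}\exp(-x/\sqrt2)$. -/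

import Mathlib

open MeasureTheory ProbabilityTheory Filter Topology
open scoped ENNReal FourierTransform

noncomputable section

namespace SIDO

/-- `W = (W t, t ∈ ℝ)` is a standard (two-sided) Wiener process under `P`: it starts from `0`, has
independent increments, `W t - W s ~ N(0, t - s)` for `s ≤ t`, and almost surely continuous
paths. -/
structure IsWienerProcess {Ω : Type*} [MeasurableSpace Ω] (W : ℝ → Ω → ℝ) (P : Measure Ω) :
    Prop where
  zero : ∀ᵐ ω ∂P, W 0 ω = 0
  indep : HasIndepIncrements W P
  law : ∀ s t : ℝ, s ≤ t →
    HasLaw (fun ω => W t ω - W s ω) (gaussianReal 0 (t - s).toNNReal) P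
  cont : ∀ᵐ ω ∂P, Continuous fun t => W t ω

/-- A step function on `ℝ`: it takes the value `val i` on `(pt i, pt (i + 1)]` for `i < n`, and
vanishes elsewhere. -/
structure StepFunction where
  n : ℕ
  pt : ℕ → ℝ
  mono : Monotone pt
  val : ℕ → ℝ

/-- The real function given by a step function. -/
def StepFunction.toFun (φ : StepFunction) (s : ℝ) : ℝ :=
  ∑ i ∈ Finset.range φ.n, (Set.Ioc (φ.pt i) (φ.pt (i + 1))).indicator (fun _ => φ.val i) s

/-- The stochastic integral `∫ φ(s) dW(s)` of a step function `φ`. -/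
def StepFunction.stochInt {Ω : Type*} (φ : StepFunction) (W : ℝ → Ω → ℝ) (ω : Ω) : ℝ :=
  ∑ i ∈ Finset.range φ.n, φ.val i * (W (φ.pt (i + 1)) ω - W (φ.pt i) ω)

/-- `ξ` is (a version of) the Wiener integral `∫ f(s) dW(s)` over `ℝ`: there are step functions
converging to `f` in `L₂(ℝ)` whose stochastic integrals converge to `ξ` in mean square.
By the Itô isometry, `ξ` is then unique up to a `P`-null set. -/
def IsWienerIntegral {Ω : Type*} [MeasurableSpace Ω] (W : ℝ → Ω → ℝ) (P : Measure Ω)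
    (f : ℝ → ℝ) (ξ : Ω → ℝ) : Prop :=
  AEStronglyMeasurable ξ P ∧
  ∃ φ : ℕ → StepFunction,
    Tendsto (fun k => eLpNorm (fun s => (φ k).toFun s - f s) 2 volume) atTop (𝓝 0) ∧
    Tendsto (fun k => eLpNorm (fun ω => (φ k).stochInt W ω - ξ ω) 2 P) atTop (𝓝 0)

/-- `Y` is the output, with almost surely continuous sample paths, of the linear time-invariant
system with impulse response function `h` and input `W`, that is,
`Y(t) = ∫ h(t - s) dW(s)` almost surely, for every `t ∈ ℝ`. -/
structure IsOutput {Ω : Type*} [MeasurableSpace Ω] (W : ℝ → Ω → ℝ) (P : Measure Ω)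
    (h : ℝ → ℝ) (Y : ℝ → Ω → ℝ) : Prop where
  integral : ∀ t : ℝ, IsWienerIntegral W P (fun s => h (t - s)) (Y t)
  cont : ∀ᵐ ω ∂P, Continuous fun t => Y t ω

open Classical in
/-- The Fourier-Plancherel transform `φ*(λ) = ∫ exp(-iλt) φ(t) dt` of a real function
`φ ∈ L₂(ℝ)` (junk value `0` for other functions). It is a function defined up to Lebesgue-null
sets. Mathlib's transform `𝓕` uses the kernel `exp(-2πiλt)`, hence the scaling. -/
def plancherel (φ : ℝ → ℝ) (l : ℝ) : ℂ :=
  if h : MemLp (fun t => (φ t : ℂ)) 2 (volume : Measure ℝ) then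
    (𝓕 (h.toLp (fun t => (φ t : ℂ))) : Lp ℂ 2 (volume : Measure ℝ)) (l / (2 * Real.pi))
  else 0

/-- The standing assumptions on the controlled kernels `(g Δ, Δ > 0)`: they are even functions of
`L₂(ℝ)`, their Fourier-Plancherel transforms are uniformly (essentially) bounded, and these
transforms converge, as `Δ → ∞`, to the constant `c ∈ (0, ∞)` uniformly on bounded intervals. -/
structure IsDeltaFamily (g : ℝ → ℝ → ℝ) (c : ℝ) : Prop where
  memLp : ∀ Δ : ℝ, 0 < Δ → MemLp (g Δ) 2 volume
  even : ∀ Δ : ℝ, 0 < Δ → ∀ t : ℝ, g Δ t = g Δ (-t)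
  bounded : (⨆ Δ : Set.Ioi (0 : ℝ), eLpNorm (plancherel (g Δ)) ∞ volume) < ∞
  c_pos : 0 < c
  tendsto : ∀ a : ℝ, 0 < a →
    Tendsto (fun Δ : ℝ => eLpNorm (fun l => plancherel (g Δ) l - (c : ℂ)) ∞
      (volume.restrict (Set.Icc (-a) a))) atTop (𝓝 0)

/-- The sample cross-correlogram `(1 / (cT)) ∫₀ᵀ Y(t + τ) X(t) dt`. -/
def estimator {Ω : Type*} (c T : ℝ) (Y X : ℝ → Ω → ℝ) (τ : ℝ) (ω : Ω) : ℝ :=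
  1 / (c * T) * ∫ t in (0 : ℝ)..T, Y (t + τ) ω * X t ω

/-- `K(x) = (1 + √2 x)^{1/2} exp(-x / √2)`. -/
def K (x : ℝ) : ℝ :=
  √(1 + √2 * x) * Real.exp (-x / √2)

end SIDO

end

/-! The correlogram is a limit of quadratic forms in jointly Gaussian variables: its Riemann sums
are bilinear in finitely many values of `Y` and `X Δ`, which are Wiener integrals against one `W`.
An orthogonal change of variables turns such a form into `∑ l i * Z i ^ 2` with independent standard
normal `Z i`, and its centred exponential moment at `u` is `∏ chaosBound (2 * u * l i)`.

The sum of the `(2 * u * l i) ^ 2` is `s ^ 2` with `s = √2 * |u| * σ`, where `σ ^ 2` is the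
variance. Since `-(log (1 - y) + y) / y ^ 2` is largest on `[-s, s]` at `s` (`sq_mul_neg_log_le`),
the product is at most `chaosBound s`: for a given variance a single chi-square variable is extremal
(`prod_chaosBound_le`, `mgf_quadraticForm_le`).

This bound depends on the form only through its variance, hence survives the passage from Riemann
sums to the integral: a uniform fourth-moment bound gives mean square convergence, so means and
variances converge, and Fatou's lemma handles the exponential moments (`exp_moment_le_of_tendsto`).
Chernoff's inequality at the optimal `u` then yields exactly `K x` (`measure_ge_le_K`). -/

noncomputable section

namespace SIDO

/-! ### The extremal inequality for products of `chaosBound`. -/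

/-- The moment generating function of the centred and normalised chi-square variable
`(Z ^ 2 - 1) / √2`, with `Z ~ N(0, 1)`, at `s / √2`. -/
def chaosBound (s : ℝ) : ℝ := Real.exp (-(Real.log (1 - s) + s) / 2)

lemma chaosBound_nonneg (s : ℝ) : 0 ≤ chaosBound s := (Real.exp_pos _).le

lemma continuousAt_chaosBound {s : ℝ} (hs : s < 1) : ContinuousAt chaosBound s := by
  unfold chaosBound
  have : (1 - s) ≠ 0 := by linarith
  fun_prop (disch := assumption)

lemma hasSum_neg_log_one_sub_sub {y : ℝ} (hy : |y| < 1) :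
    HasSum (fun n : ℕ => y ^ (n + 2) / ((n : ℝ) + 2)) (-(Real.log (1 - y) + y)) := by
  have h := (hasSum_nat_add_iff' 1).2 (Real.hasSum_pow_div_log_of_abs_lt_one hy)
  convert! h using 1
  · ext n; push_cast; ring_nf
  · simp; ring

/-- The function `y ↦ -(log (1 - y) + y) / y ^ 2` is maximal on `[-s, s]` at `s`. -/
lemma sq_mul_neg_log_le {y s : ℝ} (hy : |y| ≤ s) (hs : s < 1) :
    s ^ 2 * -(Real.log (1 - y) + y) ≤ y ^ 2 * -(Real.log (1 - s) + s) := by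
  have hs0 : 0 ≤ s := (abs_nonneg y).trans hy
  have h1 := (hasSum_neg_log_one_sub_sub (hy.trans_lt hs)).mul_left (s ^ 2)
  have h2 := (hasSum_neg_log_one_sub_sub (y := s) (by rwa [abs_of_nonneg hs0])).mul_left (y ^ 2)
  refine hasSum_le (fun n => ?_) h1 h2
  -- The power series are compared term by term: after the factor `s ^ 2 * y ^ 2 / (n + 2)` is taken
  -- out, only this remains. Negative `y` is harmless.
  have h3 : y ^ n ≤ s ^ n :=
    (le_abs_self _).trans ((abs_pow y n).trans_le (pow_le_pow_left₀ (abs_nonneg y) hy n))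
  have : s ^ 2 * (y ^ (n + 2) / ((n : ℝ) + 2)) = s ^ 2 * y ^ 2 / ((n : ℝ) + 2) * y ^ n := by ring
  rw [this]
  have : y ^ 2 * (s ^ (n + 2) / ((n : ℝ) + 2)) = s ^ 2 * y ^ 2 / ((n : ℝ) + 2) * s ^ n := by ring
  rw [this]
  gcongr

lemma prod_chaosBound_le {ι : Type*} [Fintype ι] (y : ι → ℝ) {s : ℝ} (hs0 : 0 ≤ s) (hs : s < 1)
    (hy : ∑ i, y i ^ 2 = s ^ 2) : ∏ i, chaosBound (y i) ≤ chaosBound s := by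
  simp only [chaosBound, ← Real.exp_sum]
  apply Real.exp_le_exp.2
  have hle : ∀ i, |y i| ≤ s := fun i => by
    apply abs_le_of_sq_le_sq _ hs0
    rw [← hy]
    exact Finset.single_le_sum (f := fun i => y i ^ 2) (fun i _ => sq_nonneg _) (Finset.mem_univ i)
  -- The comparison carries a factor `s ^ 2`, which cancels only for `s ≠ 0`.
  rcases hs0.eq_or_lt with h0 | h0
  · have hz : ∀ i, y i = 0 := fun i => abs_eq_zero.1 (le_antisymm (h0 ▸ hle i) (abs_nonneg _))
    simp [hz, ← h0]
  · have h := Finset.sum_le_sum fun i (_ : i ∈ Finset.univ) => sq_mul_neg_log_le (hle i) hs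
    rw [← Finset.mul_sum, ← Finset.sum_mul, hy] at h
    have h' := le_of_mul_le_mul_left h (by positivity)
    rw [← Finset.sum_div]
    simp only [Finset.sum_neg_distrib] at h' ⊢
    linarith

/-! ### Moments and exponential integrals of the standard normal law. -/

lemma integral_pow_four_gaussianReal : ∫ x, x ^ 4 ∂(gaussianReal 0 1) = 3 := by
  have h := iteratedDeriv_mgf_zero (X := fun x : ℝ => x) (μ := gaussianReal 0 1) (by simp) 4
  simp only [Pi.pow_apply] at h
  rw [← h, mgf_fun_id_gaussianReal]
  have e : ∀ t : ℝ, HasDerivAt (fun t : ℝ => Real.exp (0 * t + ((1 : NNReal) : ℝ) * t ^ 2 / 2))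
      (t * Real.exp (0 * t + ((1 : NNReal) : ℝ) * t ^ 2 / 2)) t := fun t => by
    have : HasDerivAt (fun t : ℝ => 0 * t + ((1 : NNReal) : ℝ) * t ^ 2 / 2) t t := by
      have := (((hasDerivAt_id t).const_mul (0 : ℝ)).add
        (((hasDerivAt_pow 2 t).const_mul (1 : ℝ)).div_const 2))
      convert! this using 1
      simp
    convert! this.exp using 1
    ring
  set E : ℝ → ℝ := fun t => Real.exp (0 * t + ((1 : NNReal) : ℝ) * t ^ 2 / 2) with hE
  have d1 : deriv E = fun t => t * E t := funext fun t => (e t).deriv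
  have d2 : deriv (fun t => t * E t) = fun t => (1 + t ^ 2) * E t := funext fun t => by
    have := ((hasDerivAt_id t).mul (e t)).deriv
    refine this.trans ?_
    simp [hE]; ring
  have d3 : deriv (fun t => (1 + t ^ 2) * E t) = fun t => (3 * t + t ^ 3) * E t :=
    funext fun t => by
      have := (((hasDerivAt_const t (1 : ℝ)).add (hasDerivAt_pow 2 t)).mul (e t)).deriv
      refine this.trans ?_
      simp [hE]; ring
  have d4 : deriv (fun t => (3 * t + t ^ 3) * E t) = fun t => (3 + 6 * t ^ 2 + t ^ 4) * E t :=
    funext fun t => by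
      have := ((((hasDerivAt_id t).const_mul (3 : ℝ)).add (hasDerivAt_pow 3 t)).mul (e t)).deriv
      refine this.trans ?_
      simp [hE]; ring
  rw [iteratedDeriv_succ, iteratedDeriv_succ, iteratedDeriv_succ, iteratedDeriv_one, d1, d2, d3, d4]
  simp [hE]

lemma integral_sq_gaussianReal : ∫ x, x ^ 2 ∂(gaussianReal 0 1) = 1 := by
  have h := variance_fun_id_gaussianReal (μ := 0) (v := 1)
  rw [variance_eq_integral (by fun_prop)] at h
  simpa using h

lemma memLp_sq_gaussianReal : MemLp (fun x : ℝ => x ^ 2) 2 (gaussianReal 0 1) := by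
  rw [memLp_two_iff_integrable_sq (by fun_prop)]
  have : (fun x : ℝ => (x ^ 2) ^ 2) = fun x => x ^ 4 := by ext; ring
  rw [this]
  by_contra h
  simpa [integral_undef h] using integral_pow_four_gaussianReal

lemma variance_sq_gaussianReal : Var[fun x : ℝ => x ^ 2; gaussianReal 0 1] = 2 := by
  rw [variance_eq_sub memLp_sq_gaussianReal, integral_sq_gaussianReal]
  have : (fun x : ℝ => x ^ 2) ^ 2 = fun x => x ^ 4 := by ext; simp; ring
  rw [this, integral_pow_four_gaussianReal]
  norm_num

lemma gaussianReal_exp_sq {s : ℝ} (hs : s < 1 / 2) :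
    Integrable (fun x : ℝ => Real.exp (s * x ^ 2)) (gaussianReal 0 1) ∧
      ∫ x, Real.exp (s * x ^ 2) ∂(gaussianReal 0 1) = (√(1 - 2 * s))⁻¹ := by
  have h1 : ∀ x : ℝ, gaussianPDFReal 0 1 x * Real.exp (s * x ^ 2) =
      (√(2 * Real.pi))⁻¹ * Real.exp (-(1 / 2 - s) * x ^ 2) := fun x => by
    rw [gaussianPDFReal_def, NNReal.coe_one, mul_one, mul_one, mul_assoc, ← Real.exp_add]
    congr 2
    ring
  have hb : (0 : ℝ) < 1 / 2 - s := by linarith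
  constructor
  · rw [gaussianReal_of_var_ne_zero _ one_ne_zero]
    rw [integrable_withDensity_iff_integrable_smul' (by fun_prop)
      (ae_of_all _ fun _ => gaussianPDF_lt_top)]
    simp only [toReal_gaussianPDF, smul_eq_mul, h1]
    exact (integrable_exp_neg_mul_sq hb).const_mul _
  · rw [integral_gaussianReal_eq_integral_smul one_ne_zero]
    simp only [smul_eq_mul, h1]
    rw [integral_const_mul, integral_gaussian, ← Real.sqrt_inv, ← Real.sqrt_mul (by positivity),
      ← Real.sqrt_inv]
    congr 1
    have : 1 - 2 * s ≠ 0 := by linarith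
    have : 1 / 2 - s ≠ 0 := hb.ne'
    field_simp

lemma inv_sqrt_mul_exp {s : ℝ} (hs : s < 1) :
    (√(1 - s))⁻¹ * Real.exp (-s / 2) = chaosBound s := by
  have h : 0 < 1 - s := by linarith
  rw [chaosBound, Real.sqrt_eq_rpow, ← Real.rpow_neg h.le, Real.rpow_def_of_pos h, ← Real.exp_add]
  congr 1
  ring

/-! ### Diagonal quadratic forms in independent standard normal variables. -/

section Diagonal

variable {ι : Type*} [Fintype ι] (l : ι → ℝ)

lemma integral_diagonal_gaussian :
    ∫ x : ι → ℝ, ∑ i, l i * x i ^ 2 ∂(Measure.pi fun _ => gaussianReal 0 1) = ∑ i, l i := by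
  have hi : Integrable (fun x : ℝ => x ^ 2) (gaussianReal 0 1) :=
    memLp_sq_gaussianReal.integrable (by norm_num)
  rw [integral_finsetSum]
  · refine Finset.sum_congr rfl fun i _ => ?_
    rw [integral_const_mul, integral_comp_eval (μ := fun _ : ι => gaussianReal 0 1) (i := i)
      (f := fun x : ℝ => x ^ 2) hi.aestronglyMeasurable, integral_sq_gaussianReal, mul_one]
  · intro i _
    exact ((measurePreserving_eval (fun _ : ι => gaussianReal 0 1) i).integrable_comp
      hi.aestronglyMeasurable).2 hi |>.const_mul _

lemma variance_diagonal_gaussian :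
    Var[fun x : ι → ℝ => ∑ i, l i * x i ^ 2; Measure.pi fun _ => gaussianReal 0 1] =
      2 * ∑ i, l i ^ 2 := by
  have h := variance_sum_pi (μ := fun _ : ι => gaussianReal 0 1)
    (X := fun i (x : ℝ) => l i * x ^ 2) fun i => memLp_sq_gaussianReal.const_mul (l i)
  have e : (∑ i, fun ω : ι → ℝ => l i * ω i ^ 2) = fun x : ι → ℝ => ∑ i, l i * x i ^ 2 := by
    ext; simp
  rw [e] at h
  rw [h, Finset.mul_sum]
  refine Finset.sum_congr rfl fun i _ => ?_
  rw [variance_const_mul, variance_sq_gaussianReal]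
  ring

/-- By independence the integral factors, and the factor at `i` is `chaosBound (2 * u * l i)`. The
condition on the sum of squares forces each `2 * u * l i < 1`, so every factor is finite. -/
lemma mgf_diagonal_gaussian_le {u s : ℝ} (hs0 : 0 ≤ s) (hs : s < 1)
    (hl : ∑ i, (2 * u * l i) ^ 2 = s ^ 2) :
    Integrable (fun x : ι → ℝ => Real.exp (u * (∑ i, l i * x i ^ 2 - ∑ i, l i)))
        (Measure.pi fun _ => gaussianReal 0 1) ∧
      ∫ x : ι → ℝ, Real.exp (u * (∑ i, l i * x i ^ 2 - ∑ i, l i))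
        ∂(Measure.pi fun _ => gaussianReal 0 1) ≤ chaosBound s := by
  have hlt : ∀ i, 2 * u * l i < 1 := fun i => by
    have : (2 * u * l i) ^ 2 ≤ s ^ 2 := by
      rw [← hl]
      exact Finset.single_le_sum (f := fun i => (2 * u * l i) ^ 2) (fun i _ => sq_nonneg _)
        (Finset.mem_univ i)
    exact ((le_abs_self _).trans (abs_le_of_sq_le_sq this hs0)).trans_lt hs
  have hlt' : ∀ i, u * l i < 1 / 2 := fun i => by linarith [hlt i]
  have e : ∀ x : ι → ℝ, Real.exp (u * (∑ i, l i * x i ^ 2 - ∑ i, l i)) =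
      ∏ i, Real.exp (u * l i * x i ^ 2) * Real.exp (-(2 * u * l i) / 2) := fun x => by
    simp only [← Real.exp_add, ← Real.exp_sum]
    congr 1
    rw [← Finset.sum_sub_distrib, Finset.mul_sum]
    exact Finset.sum_congr rfl fun i _ => by ring
  simp only [e]
  constructor
  · exact Integrable.fintype_prod (f := fun i (x : ℝ) =>
      Real.exp (u * l i * x ^ 2) * Real.exp (-(2 * u * l i) / 2))
      fun i => (gaussianReal_exp_sq (hlt' i)).1.mul_const _
  · rw [integral_fintype_prod_eq_prod (f := fun i (x : ℝ) =>
      Real.exp (u * l i * x ^ 2) * Real.exp (-(2 * u * l i) / 2))]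
    refine le_trans (le_of_eq (Finset.prod_congr rfl fun i _ => ?_))
      (prod_chaosBound_le (fun i => 2 * u * l i) hs0 hs hl)
    rw [integral_mul_const, (gaussianReal_exp_sq (hlt' i)).2, ← inv_sqrt_mul_exp (hlt i)]
    ring_nf

end Diagonal

/-! ### General quadratic forms in centred Gaussian vectors. -/

section QuadraticForm

open Matrix WithLp
open scoped MatrixOrder

variable {ι : Type*} [Fintype ι] [DecidableEq ι]

/-- A centred Gaussian measure on a Euclidean space is a linear image of the standard one. -/
lemma exists_map_stdGaussian (μ : Measure (EuclideanSpace ℝ ι)) [IsGaussian μ] (hμ : μ[id] = 0) :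
    ∃ R : Matrix ι ι ℝ, μ = (stdGaussian (EuclideanSpace ℝ ι)).map (toEuclideanCLM (𝕜 := ℝ) R) := by
  set e := EuclideanSpace.basisFun ι ℝ with he
  set S : Matrix ι ι ℝ := Matrix.of fun i j => covarianceBilin μ (e i) (e j) with hS
  have key : ∀ x y : EuclideanSpace ℝ ι, covarianceBilin μ x y = x ⬝ᵥ S *ᵥ y := fun x y => by
    conv_lhs => rw [← e.sum_repr x, ← e.sum_repr y]
    simp only [map_sum, map_smul, _root_.sum_apply, _root_.smul_apply,
      smul_eq_mul, dotProduct, mulVec, hS, Matrix.of_apply, Finset.mul_sum]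
    rw [Finset.sum_comm]
    refine Finset.sum_congr rfl fun i _ => Finset.sum_congr rfl fun j _ => ?_
    simp [he]
    ring
  have hpos : S.PosSemidef := by
    refine Matrix.PosSemidef.of_dotProduct_mulVec_nonneg ?_ fun x => ?_
    · ext i j
      simp [hS, covarianceBilin_comm (e j)]
    · have := key (toLp 2 x) (toLp 2 x)
      simp only [star_trivial]
      exact (covarianceBilin_self_nonneg (μ := μ) (toLp 2 x)).trans_eq this
  -- A square root of the covariance matrix sends the standard Gaussian law to one with covariance
  -- `S`; mean and covariance determine a Gaussian law.
  refine ⟨CFC.sqrt S, ?_⟩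
  have : μ = multivariateGaussian 0 S := by
    refine IsGaussian.ext (by rw [hμ]; simp) ?_
    ext x y
    rw [covarianceBilin_multivariateGaussian hpos, key]
  conv_lhs => rw [this, multivariateGaussian]
  simp

/-- A quadratic form in independent standard Gaussian variables is diagonalised by an
orthogonal change of variables. -/
lemma map_quadraticForm_stdGaussian (A : Matrix ι ι ℝ) : ∃ l : ι → ℝ,
    (stdGaussian (EuclideanSpace ℝ ι)).map (fun x => ofLp x ⬝ᵥ A *ᵥ ofLp x) =
      (Measure.pi fun _ : ι => gaussianReal 0 1).map (fun x => ∑ i, l i * x i ^ 2) := by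
  -- Only the symmetric part of `A` matters for the form, and the spectral theorem applies to it.
  -- The `l i` are its eigenvalues.
  set M : Matrix ι ι ℝ := (1 / 2 : ℝ) • (A + Aᵀ) with hMdef
  have hM : M.IsHermitian := by
    rw [Matrix.IsHermitian, hMdef, conjTranspose_eq_transpose_of_trivial, transpose_smul,
      transpose_add, transpose_transpose, add_comm]
  have hAM : ∀ x : ι → ℝ, x ⬝ᵥ A *ᵥ x = x ⬝ᵥ M *ᵥ x := fun x => by
    have : x ⬝ᵥ Aᵀ *ᵥ x = x ⬝ᵥ A *ᵥ x := by
      rw [mulVec_transpose, dotProduct_comm, dotProduct_mulVec]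
    rw [hMdef, smul_mulVec, add_mulVec, dotProduct_smul, dotProduct_add, this, smul_eq_mul]
    ring
  set b := hM.eigenvectorBasis with hb
  refine ⟨hM.eigenvalues, ?_⟩
  have hmeas : Measurable fun x : EuclideanSpace ℝ ι => (x : ι → ℝ) ⬝ᵥ A *ᵥ x := by
    simp only [dotProduct, mulVec]
    fun_prop
  rw [stdGaussian_eq_map_pi_orthonormalBasis b, Measure.map_map hmeas (by fun_prop)]
  congr 1
  funext x
  simp only [Function.comp_apply, hAM]
  have h1 : M *ᵥ (ofLp (∑ i, x i • b i)) = ofLp (∑ i, (hM.eigenvalues i * x i) • b i) := by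
    simp only [ofLp_sum, ofLp_smul, Matrix.mulVec_sum, Matrix.mulVec_smul, hb,
      hM.mulVec_eigenvectorBasis, smul_smul]
    exact Finset.sum_congr rfl fun i _ => by rw [mul_comm]
  rw [h1]
  have h2 : ∀ v w : EuclideanSpace ℝ ι, ofLp v ⬝ᵥ ofLp w = inner ℝ w v := fun v w => by
    simp [EuclideanSpace.inner_eq_star_dotProduct]
  rw [h2, b.orthonormal.inner_sum]
  exact Finset.sum_congr rfl fun i _ => by simp; ring

variable {Ω : Type*} [MeasurableSpace Ω] {P : Measure Ω}

/-- Writing the vector in law as `R` times a standard one turns the form of `A` into that of `Rᵀ * A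
* R`, which is then diagonalised. No nondegeneracy of the covariance is needed. -/
lemma exists_map_quadraticForm {V : ι → Ω → ℝ}
    (hV : HasGaussianLaw (fun ω => toLp 2 fun i => V i ω) P) (h0 : ∀ i, ∫ ω, V i ω ∂P = 0)
    (A : Matrix ι ι ℝ) : ∃ l : ι → ℝ,
    P.map (fun ω => (fun i => V i ω) ⬝ᵥ A *ᵥ (fun i => V i ω)) =
      (Measure.pi fun _ : ι => gaussianReal 0 1).map (fun x => ∑ i, l i * x i ^ 2) := by
  have hmeas : ∀ A : Matrix ι ι ℝ, Measurable fun x : EuclideanSpace ℝ ι => (x : ι → ℝ) ⬝ᵥ A *ᵥ x := by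
    intro A
    simp only [dotProduct, mulVec]
    fun_prop
  have := hV.isGaussian_map
  have hmean : (P.map fun ω => toLp 2 fun i => V i ω)[id] = (0 : EuclideanSpace ℝ ι) := by
    rw [integral_map hV.aemeasurable aestronglyMeasurable_id]
    ext i
    have h := (EuclideanSpace.proj i : EuclideanSpace ℝ ι →L[ℝ] ℝ).integral_comp_comm hV.integrable
    simp only [id, PiLp.zero_apply]
    exact h.symm.trans (h0 i)
  obtain ⟨R, hR⟩ := exists_map_stdGaussian _ hmean
  obtain ⟨l, hl⟩ := map_quadraticForm_stdGaussian (Rᵀ * A * R)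
  refine ⟨l, ?_⟩
  rw [← hl]
  have e1 : (fun ω => (fun i => V i ω) ⬝ᵥ A *ᵥ (fun i => V i ω)) =
    (fun x : EuclideanSpace ℝ ι => (x : ι → ℝ) ⬝ᵥ A *ᵥ x) ∘ (fun ω => toLp 2 fun i => V i ω) := rfl
  rw [e1, ← AEMeasurable.map_map_of_aemeasurable (hmeas A).aemeasurable hV.aemeasurable, hR,
    Measure.map_map (hmeas A) (by fun_prop)]
  congr 1
  funext x
  simp only [Function.comp_apply, ofLp_toEuclideanCLM]
  rw [← mulVec_mulVec, ← mulVec_mulVec, dotProduct_mulVec (x : ι → ℝ) Rᵀ, vecMul_transpose]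

/-- The exponential moments of a centred quadratic form in Gaussian variables are dominated by
those of a centred chi-square variable with the same variance. -/
lemma mgf_quadraticForm_le {V : ι → Ω → ℝ}
    (hV : HasGaussianLaw (fun ω => toLp 2 fun i => V i ω) P) (h0 : ∀ i, ∫ ω, V i ω ∂P = 0)
    (A : Matrix ι ι ℝ) {Q : Ω → ℝ} (hQ : ∀ ω, Q ω = (fun i => V i ω) ⬝ᵥ A *ᵥ (fun i => V i ω))
    {u : ℝ} (hu : √2 * |u| * √(Var[Q; P]) < 1) :
    ∫⁻ ω, ENNReal.ofReal (Real.exp (u * (Q ω - P[Q]))) ∂P ≤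
      ENNReal.ofReal (chaosBound (√2 * |u| * √(Var[Q; P]))) := by
  obtain ⟨l, hl⟩ := exists_map_quadraticForm hV h0 A
  have hQm : AEMeasurable Q P := by
    have : ∀ i, AEMeasurable (V i) P := fun i =>
      (EuclideanSpace.proj i : EuclideanSpace ℝ ι →L[ℝ] ℝ).measurable.comp_aemeasurable hV.aemeasurable
    simp only [funext hQ, dotProduct, mulVec]
    fun_prop
  rw [← funext hQ] at hl
  set D : (ι → ℝ) → ℝ := fun x => ∑ i, l i * x i ^ 2 with hD
  have hDm : Measurable D := by fun_prop
  have hmean : P[Q] = ∑ i, l i := by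
    have h1 := integral_map hQm (f := id) aestronglyMeasurable_id
    have h2 := integral_map hDm.aemeasurable (f := id) (μ := Measure.pi fun _ : ι => gaussianReal 0 1)
      aestronglyMeasurable_id
    rw [hl, h2] at h1
    simp only [id] at h1
    rw [← h1, integral_diagonal_gaussian]
  have hvar : Var[Q; P] = 2 * ∑ i, l i ^ 2 := by
    have h1 := variance_map (X := id) (Y := Q) (μ := P) aemeasurable_id hQm
    have h2 := variance_map (X := id) (Y := D) (μ := Measure.pi fun _ : ι => gaussianReal 0 1)
      aemeasurable_id hDm.aemeasurable
    rw [hl, h2] at h1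
    simp only [Function.id_comp] at h1
    rw [← h1, variance_diagonal_gaussian]
  have hs0 : 0 ≤ √2 * |u| * √(Var[Q; P]) := by positivity
  -- Both sides equal `2 * u ^ 2 * Var[Q; P]`, because each `Z ^ 2` has variance `2`.
  have hsq : ∑ i, (2 * u * l i) ^ 2 = (√2 * |u| * √(Var[Q; P])) ^ 2 := by
    rw [mul_pow, mul_pow, Real.sq_sqrt (variance_nonneg _ _), Real.sq_sqrt (by norm_num), sq_abs,
      hvar]
    simp only [mul_pow, ← Finset.mul_sum]
    ring
  obtain ⟨hi, hle⟩ := mgf_diagonal_gaussian_le l hs0 hu hsq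
  rw [hmean]
  have hf : Measurable fun y : ℝ => ENNReal.ofReal (Real.exp (u * (y - ∑ i, l i))) := by fun_prop
  rw [← lintegral_map' (f := fun y : ℝ => ENNReal.ofReal (Real.exp (u * (y - ∑ i, l i))))
    hf.aemeasurable hQm, hl, lintegral_map hf hDm,
    ← ofReal_integral_eq_lintegral_ofReal hi (ae_of_all _ fun _ => (Real.exp_pos _).le)]
  exact ENNReal.ofReal_le_ofReal hle

end QuadraticForm

/-! ### Mean square limits: moments and Gaussianity. -/

section L2Convergence

variable {α : Type*} [MeasurableSpace α] {μ : Measure α} {f : ℕ → α → ℝ} {g : α → ℝ}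

lemma memLp_of_tendsto_eLpNorm {p : ℝ≥0∞} (hf : ∀ n, MemLp (f n) p μ)
    (hg : AEStronglyMeasurable g μ)
    (h : Tendsto (fun n => eLpNorm (fun x => f n x - g x) p μ) atTop (𝓝 0)) : MemLp g p μ := by
  obtain ⟨n, hn⟩ := (h.eventually (gt_mem_nhds ENNReal.zero_lt_top)).exists
  have : MemLp (fun x => f n x - g x) p μ := ⟨(hf n).1.sub hg, hn⟩
  convert! (hf n).sub this using 1
  ext x
  simp

lemma tendsto_integral_sq (hf : ∀ n, MemLp (f n) 2 μ) (hg : MemLp g 2 μ)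
    (h : Tendsto (fun n => eLpNorm (fun x => f n x - g x) 2 μ) atTop (𝓝 0)) :
    Tendsto (fun n => ∫ x, f n x ^ 2 ∂μ) atTop (𝓝 (∫ x, g x ^ 2 ∂μ)) := by
  have h1 := (Lp.tendsto_Lp_iff_tendsto_eLpNorm'' f hf g hg).2 h
  have key : ∀ {k : α → ℝ} (hk : MemLp k 2 μ), ‖hk.toLp k‖ ^ 2 = ∫ x, k x ^ 2 ∂μ := fun {k} hk => by
    rw [← real_inner_self_eq_norm_sq, L2.inner_def]
    refine integral_congr_ae ?_
    filter_upwards [hk.coeFn_toLp] with x hx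
    rw [hx]
    simp [sq]
  have h2 := (h1.norm).pow 2
  simpa only [key] using h2

variable [IsProbabilityMeasure μ]

lemma tendsto_integral_of_L2 (hf : ∀ n, MemLp (f n) 2 μ) (hg : MemLp g 2 μ)
    (h : Tendsto (fun n => eLpNorm (fun x => f n x - g x) 2 μ) atTop (𝓝 0)) :
    Tendsto (fun n => ∫ x, f n x ∂μ) atTop (𝓝 (∫ x, g x ∂μ)) := by
  refine tendsto_integral_of_L1' g hg.1
    (Eventually.of_forall fun n => (hf n).integrable (by norm_num)) ?_
  refine tendsto_of_tendsto_of_tendsto_of_le_of_le tendsto_const_nhds h (fun _ => zero_le)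
    fun n => ?_
  exact eLpNorm_le_eLpNorm_of_exponent_le (by norm_num) ((hf n).1.sub hg.1)

lemma tendsto_variance_of_L2 (hf : ∀ n, MemLp (f n) 2 μ) (hg : MemLp g 2 μ)
    (h : Tendsto (fun n => eLpNorm (fun x => f n x - g x) 2 μ) atTop (𝓝 0)) :
    Tendsto (fun n => Var[f n; μ]) atTop (𝓝 Var[g; μ]) := by
  simp only [variance_eq_sub (hf _), variance_eq_sub hg]
  exact (tendsto_integral_sq hf hg h).sub ((tendsto_integral_of_L2 hf hg h).pow 2)

/-- Mean square limits of real Gaussian variables are Gaussian. -/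
lemma hasGaussianLaw_of_L2 (hf : ∀ n, HasGaussianLaw (f n) μ) (hg : AEStronglyMeasurable g μ)
    (h : Tendsto (fun n => eLpNorm (fun x => f n x - g x) 2 μ) atTop (𝓝 0)) :
    HasGaussianLaw g μ := by
  have hf2 : ∀ n, MemLp (f n) 2 μ := fun n => (hf n).memLp_two
  have hg2 : MemLp g 2 μ := memLp_of_tendsto_eLpNorm hf2 hg h
  have hd := (tendstoInMeasure_of_tendsto_eLpNorm (by norm_num) (fun n => (hf2 n).1) hg
    h).tendstoInDistribution fun n => (hf n).aemeasurable
  -- Characteristic functions converge by convergence in law, and also to the Gaussian expression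
  -- because means and variances converge; the two limits coincide.
  have hc := ProbabilityMeasure.tendsto_iff_tendsto_charFun.1 hd.tendsto
  refine (hasGaussianLaw_iff_charFun_map_eq hg.aemeasurable).2 fun t => ?_
  refine tendsto_nhds_unique (hc t) ?_
  simp only [ProbabilityMeasure.coe_mk, (hf _).charFun_map_eq]
  have e : ∀ k : α → ℝ, (fun ω => inner ℝ t (k ω)) = fun ω => t * k ω := fun k => by
    ext ω; simp [mul_comm]
  simp only [e, integral_const_mul, variance_const_mul]
  have h1 := tendsto_integral_of_L2 hf2 hg2 h
  have h2 := tendsto_variance_of_L2 hf2 hg2 h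
  have h3 : Continuous fun p : ℝ × ℝ =>
      Complex.exp (((t * p.1 : ℝ) : ℂ) * Complex.I - ((t ^ 2 * p.2 : ℝ) : ℂ) / 2) := by fun_prop
  exact (h3.tendsto _).comp (h1.prodMk_nhds h2)

end L2Convergence

/-! ### Wiener integrals: joint Gaussianity and the Itô isometry. -/

section Wiener

open Set

variable {Ω : Type*} [MeasurableSpace Ω] {P : Measure Ω} {W : ℝ → Ω → ℝ}

lemma IsWienerProcess.isGaussianProcess_shift (hW : IsWienerProcess W P) (a : ℝ) :
    IsGaussianProcess (fun (t : NNReal) ω => W (a + t) ω - W a ω) P := by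
  refine HasIndepIncrements.isGaussianProcess (fun t => ?_) ?_ fun n t ht => ?_
  · exact (hW.law a (a + t) (by simp)).hasGaussianLaw
  · simp
  · have := hW.indep n (fun i => a + t i) fun i j hij => by
      have : ((t i : ℝ)) ≤ t j := by exact_mod_cast ht hij
      simpa using this
    simpa using this

lemma IsWienerProcess.isGaussianProcess (hW : IsWienerProcess W P) : IsGaussianProcess W P where
  hasGaussianLaw I := by
    -- All the times and `0` are seen from a base point `a` to their left, where the increments form
    -- a Gaussian process on a half-line. Then `W t = W t - W 0` almost surely is a difference of
    -- two such increments.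
    obtain ⟨a, ha⟩ := (insert 0 I).bddBelow
    have ha0 : a ≤ 0 := ha (Finset.mem_insert_self _ _)
    have haI : ∀ t : I, a ≤ t := fun t => ha (Finset.mem_insert_of_mem t.2)
    let s : ℝ → NNReal := fun t => (t - a).toNNReal
    have hG : IsGaussianProcess (fun (t : I) ω => W t ω - W 0 ω) P := by
      have hS := hW.isGaussianProcess_shift a
      refine IsGaussianProcess.of_isGaussianProcess hS fun t =>
        ⟨{s t, s 0}, ContinuousLinearMap.proj (R := ℝ) (φ := fun _ => ℝ) ⟨s t, by simp⟩ -
          ContinuousLinearMap.proj (R := ℝ) (φ := fun _ => ℝ) ⟨s 0, by simp⟩, fun ω => ?_⟩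
      have h1 : a + (s t : ℝ) = t := by
        simp only [s]; rw [Real.coe_toNNReal _ (by linarith [haI t])]; ring
      have h2 : a + (s 0 : ℝ) = 0 := by
        simp only [s]; rw [Real.coe_toNNReal _ (by linarith)]; ring
      simp [h1, h2]
    have h := (hG.hasGaussianLaw Finset.univ).map
      (ContinuousLinearMap.pi fun t : I => ContinuousLinearMap.proj (R := ℝ) (φ := fun _ => ℝ)
        (⟨t, Finset.mem_univ t⟩ : (Finset.univ : Finset I)))
    refine h.congr ?_
    filter_upwards [hW.zero] with ω hω
    ext t
    change W t ω - W 0 ω = W t ω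
    rw [hω, sub_zero]

lemma IsWienerProcess.isGaussianProcess_stochInt (hW : IsWienerProcess W P) :
    IsGaussianProcess (fun (φ : StepFunction) ω => φ.stochInt W ω) P := by
  refine hW.isGaussianProcess.of_isGaussianProcess fun φ =>
    ⟨(Finset.range (φ.n + 1)).image φ.pt, ∑ i ∈ (Finset.range φ.n).attach, φ.val i •
      (ContinuousLinearMap.proj (R := ℝ) (φ := fun _ => ℝ) ⟨φ.pt (i + 1), by
        have := Finset.mem_range.1 i.2
        exact Finset.mem_image_of_mem _ (Finset.mem_range.2 (by omega))⟩ -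
      ContinuousLinearMap.proj (R := ℝ) (φ := fun _ => ℝ) ⟨φ.pt i, by
        have := Finset.mem_range.1 i.2
        exact Finset.mem_image_of_mem _ (Finset.mem_range.2 (by omega))⟩), fun ω => ?_⟩
  rw [StepFunction.stochInt, ← Finset.sum_attach]
  simp

lemma IsWienerProcess.integral_stochInt (hW : IsWienerProcess W P) (φ : StepFunction) :
    ∫ ω, φ.stochInt W ω ∂P = 0 := by
  have h : ∀ i, HasLaw (fun ω => W (φ.pt (i + 1)) ω - W (φ.pt i) ω)
      (gaussianReal 0 (φ.pt (i + 1) - φ.pt i).toNNReal) P := fun i =>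
    hW.law _ _ (φ.mono (Nat.le_succ i))
  unfold StepFunction.stochInt
  rw [integral_finsetSum _ fun i _ => (h i).hasGaussianLaw.integrable.const_mul _]
  refine Finset.sum_eq_zero fun i _ => ?_
  rw [integral_const_mul, (h i).integral_eq]
  simp

lemma IsWienerProcess.variance_stochInt (hW : IsWienerProcess W P) (φ : StepFunction) :
    Var[fun ω => φ.stochInt W ω; P] =
      ∑ i ∈ Finset.range φ.n, φ.val i ^ 2 * (φ.pt (i + 1) - φ.pt i) := by
  have h : ∀ i, HasLaw (fun ω => W (φ.pt (i + 1)) ω - W (φ.pt i) ω)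
      (gaussianReal 0 (φ.pt (i + 1) - φ.pt i).toNNReal) P := fun i =>
    hW.law _ _ (φ.mono (Nat.le_succ i))
  have e : (fun ω => φ.stochInt W ω) = ∑ i ∈ Finset.range φ.n,
      fun ω => φ.val i * (W (φ.pt (i + 1)) ω - W (φ.pt i) ω) := by
    ext ω; simp [StepFunction.stochInt]
  rw [e, IndepFun.variance_sum fun i _ => (h i).hasGaussianLaw.memLp_two.const_mul _]
  · refine Finset.sum_congr rfl fun i _ => ?_
    rw [variance_const_mul, (h i).variance_eq, variance_id_gaussianReal,
      Real.coe_toNNReal _ (sub_nonneg.2 (φ.mono (Nat.le_succ i)))]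
  · intro i _ j _ hij
    exact ((hW.indep.nat φ.mono).indepFun hij).comp (measurable_const_mul (φ.val i))
      (measurable_const_mul (φ.val j))

/-- The intervals are disjoint, so the cross terms vanish. This matches the independence of
increments used in `IsWienerProcess.variance_stochInt`. -/
lemma StepFunction.toFun_sq (φ : StepFunction) (s : ℝ) :
    φ.toFun s ^ 2 = ∑ i ∈ Finset.range φ.n,
      (Ioc (φ.pt i) (φ.pt (i + 1))).indicator (fun _ => φ.val i ^ 2) s := by
  have hd := φ.mono.pairwise_disjoint_on_Ioc_succ
  rw [StepFunction.toFun, sq, Finset.sum_mul_sum]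
  refine Finset.sum_congr rfl fun i hi => ?_
  rw [Finset.sum_eq_single i]
  · by_cases hs : s ∈ Ioc (φ.pt i) (φ.pt (i + 1))
    · simp [hs, sq]
    · simp only [indicator_of_notMem hs, mul_zero]
  · intro j _ hj
    by_cases hs : s ∈ Ioc (φ.pt i) (φ.pt (i + 1))
    · have : s ∉ Ioc (φ.pt j) (φ.pt (j + 1)) := fun h =>
        Set.disjoint_left.1 (hd hj.symm) hs h
      simp only [indicator_of_notMem this, mul_zero]
    · simp only [indicator_of_notMem hs, zero_mul]
  · exact fun h => absurd hi h

lemma StepFunction.memLp (φ : StepFunction) : MemLp φ.toFun 2 volume := by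
  have : φ.toFun = fun s => ∑ i ∈ Finset.range φ.n,
    (Ioc (φ.pt i) (φ.pt (i + 1))).indicator (fun _ => φ.val i) s := rfl
  rw [this]
  exact memLp_finsetSum _ fun i _ => memLp_indicator_const 2 measurableSet_Ioc _
    (Or.inr measure_Ioc_lt_top.ne)

lemma StepFunction.integral_toFun_sq (φ : StepFunction) :
    ∫ s, φ.toFun s ^ 2 = ∑ i ∈ Finset.range φ.n, φ.val i ^ 2 * (φ.pt (i + 1) - φ.pt i) := by
  simp only [φ.toFun_sq]
  rw [integral_finsetSum]
  · refine Finset.sum_congr rfl fun i _ => ?_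
    rw [integral_indicator measurableSet_Ioc]
    simp [φ.mono (Nat.le_succ i), mul_comm]
  · intro i _
    exact (integrable_indicator_iff measurableSet_Ioc).2 (integrableOn_const measure_Ioc_lt_top.ne)

variable [IsProbabilityMeasure P]

/-- Any finite family of Wiener integrals is jointly Gaussian. -/
lemma hasGaussianLaw_wienerIntegrals (hW : IsWienerProcess W P) {ι : Type*} [Fintype ι]
    {f : ι → ℝ → ℝ} {ξ : ι → Ω → ℝ} (hξ : ∀ i, IsWienerIntegral W P (f i) (ξ i)) :
    HasGaussianLaw (fun ω => WithLp.toLp 2 fun i => ξ i ω) P := by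
  classical
  have hm : ∀ i, AEStronglyMeasurable (ξ i) P := fun i => (hξ i).1
  choose φ _ hφ using fun i => (hξ i).2
  have hmeas : AEMeasurable (fun ω => WithLp.toLp 2 fun i => ξ i ω) P := by
    have := fun i => (hm i).aemeasurable
    fun_prop
  refine ⟨⟨fun L => ?_⟩⟩
  -- It suffices that every linear functional of the vector is Gaussian; each one is a mean square
  -- limit of linear combinations of step-function integrals.
  suffices hL : HasGaussianLaw (fun ω => L (WithLp.toLp 2 fun i => ξ i ω)) P by
    have h1 : (P.map (fun ω => WithLp.toLp 2 fun i => ξ i ω)).map L =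
        P.map (fun ω => L (WithLp.toLp 2 fun i => ξ i ω)) :=
      AEMeasurable.map_map_of_aemeasurable L.continuous.aemeasurable hmeas
    rw [h1, hL.map_eq_gaussianReal, integral_map hmeas L.continuous.aestronglyMeasurable,
      variance_map L.continuous.aemeasurable hmeas]
    rfl
  have hLe : ∀ v : ι → ℝ, L (WithLp.toLp 2 v) = ∑ i, v i * L (EuclideanSpace.single i 1) :=
    fun v => by
      conv_lhs => rw [← (EuclideanSpace.basisFun ι ℝ).sum_repr (WithLp.toLp 2 v)]
      simp
  rw [funext fun ω => hLe fun i => ξ i ω]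
  refine hasGaussianLaw_of_L2
    (f := fun k ω => ∑ i, (φ i k).stochInt W ω * L (EuclideanSpace.single i 1)) (fun k => ?_)
    (Finset.aestronglyMeasurable_fun_sum _ fun i _ => (hm i).mul_const _) ?_
  · have hG : IsGaussianProcess (fun (i : ι) ω =>
        (φ i k).stochInt W ω * L (EuclideanSpace.single i 1)) P := by
      have := (hW.isGaussianProcess_stochInt.comp_right fun i : ι => φ i k).smul
        fun i => L (EuclideanSpace.single i 1)
      simpa [mul_comm] using this
    exact hG.hasGaussianLaw_fun_sum (I := Finset.univ)
  · have hst : ∀ i k, MemLp (fun ω => (φ i k).stochInt W ω) 2 P := fun i k =>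
      (hW.isGaussianProcess_stochInt.hasGaussianLaw_eval (φ i k)).memLp_two
    have hle : ∀ k, eLpNorm (fun ω => ∑ i, (φ i k).stochInt W ω * L (EuclideanSpace.single i 1) -
        ∑ i, ξ i ω * L (EuclideanSpace.single i 1)) 2 P ≤
        ∑ i, ‖L (EuclideanSpace.single i 1)‖ₑ *
          eLpNorm (fun ω => (φ i k).stochInt W ω - ξ i ω) 2 P := fun k => by
      have e : (fun ω => ∑ i, (φ i k).stochInt W ω * L (EuclideanSpace.single i 1) -
          ∑ i, ξ i ω * L (EuclideanSpace.single i 1)) =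
          ∑ i, L (EuclideanSpace.single i 1) • fun ω => (φ i k).stochInt W ω - ξ i ω := by
        ext ω
        simp only [Finset.sum_apply, Pi.smul_apply, smul_eq_mul, ← Finset.sum_sub_distrib]
        exact Finset.sum_congr rfl fun i _ => by ring
      rw [e]
      refine (eLpNorm_sum_le (fun i _ => (((hst i k).1.sub (hm i)).const_smul _)) (by norm_num)).trans ?_
      exact Finset.sum_le_sum fun i _ => (eLpNorm_const_smul _ _ _ _).le
    refine tendsto_of_tendsto_of_tendsto_of_le_of_le tendsto_const_nhds ?_ (fun _ => zero_le) hle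
    have : Tendsto (fun k => ∑ i, ‖L (EuclideanSpace.single i 1)‖ₑ *
          eLpNorm (fun ω => (φ i k).stochInt W ω - ξ i ω) 2 P) atTop
        (𝓝 (∑ i : ι, ‖L (EuclideanSpace.single i 1)‖ₑ * 0)) :=
      tendsto_finsetSum _ fun i _ => ENNReal.Tendsto.const_mul (hφ i) (Or.inr enorm_ne_top)
    simpa using this

lemma IsWienerIntegral.hasGaussianLaw (hW : IsWienerProcess W P) {f : ℝ → ℝ} {ξ : Ω → ℝ}
    (hξ : IsWienerIntegral W P f ξ) : HasGaussianLaw ξ P := by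
  obtain ⟨hm, φ, _, hφ⟩ := hξ
  exact hasGaussianLaw_of_L2 (fun k => hW.isGaussianProcess_stochInt.hasGaussianLaw_eval (φ k)) hm hφ

lemma IsWienerIntegral.integral_eq_zero (hW : IsWienerProcess W P) {f : ℝ → ℝ} {ξ : Ω → ℝ}
    (hξ : IsWienerIntegral W P f ξ) : ∫ ω, ξ ω ∂P = 0 := by
  have hm := (hξ.hasGaussianLaw hW).memLp_two
  obtain ⟨_, φ, _, hφ⟩ := hξ
  have hst : ∀ k, MemLp (fun ω => (φ k).stochInt W ω) 2 P := fun k =>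
    (hW.isGaussianProcess_stochInt.hasGaussianLaw_eval (φ k)).memLp_two
  refine tendsto_nhds_unique (tendsto_integral_of_L2 hst hm hφ) ?_
  simp only [hW.integral_stochInt, tendsto_const_nhds_iff]

/-- **Itô isometry**. -/
lemma IsWienerIntegral.variance_eq (hW : IsWienerProcess W P) {f : ℝ → ℝ} {ξ : Ω → ℝ}
    (hξ : IsWienerIntegral W P f ξ) (hf : MemLp f 2 volume) : Var[ξ; P] = ∫ s, f s ^ 2 := by
  have hm := (hξ.hasGaussianLaw hW).memLp_two
  obtain ⟨_, φ, hφf, hφ⟩ := hξ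
  have hst : ∀ k, MemLp (fun ω => (φ k).stochInt W ω) 2 P := fun k =>
    (hW.isGaussianProcess_stochInt.hasGaussianLaw_eval (φ k)).memLp_two
  refine tendsto_nhds_unique (tendsto_variance_of_L2 hst hm hφ) ?_
  simp only [hW.variance_stochInt, ← StepFunction.integral_toFun_sq]
  exact tendsto_integral_sq (fun k => (φ k).memLp) hf hφf

/-- The output of a time-invariant system driven by a Wiener process has a marginal law that does
not depend on time. -/
lemma IsOutput.map_eq (hW : IsWienerProcess W P) {h : ℝ → ℝ} {Y : ℝ → Ω → ℝ}
    (hY : IsOutput W P h Y) (hh : MemLp h 2 volume) (t : ℝ) :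
    P.map (Y t) = gaussianReal 0 (∫ s, h s ^ 2).toNNReal := by
  rw [((hY.integral t).hasGaussianLaw hW).map_eq_gaussianReal, (hY.integral t).integral_eq_zero hW,
    (hY.integral t).variance_eq hW
      (hh.comp_measurePreserving (volume.measurePreserving_sub_left t)),
    integral_sub_left_eq_self (fun s => h s ^ 2)]

end Wiener

/-! ### Riemann sums of continuous functions. -/

/-- Left Riemann sums of a continuous function converge to its integral. -/
lemma tendsto_riemannSum {F : ℝ → ℝ} (hF : Continuous F) {T : ℝ} (hT : 0 < T) :
    Tendsto (fun n : ℕ => T / (n + 1) * ∑ i ∈ Finset.range (n + 1), F (T * i / (n + 1))) atTop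
      (𝓝 (∫ t in (0 : ℝ)..T, F t)) := by
  rw [Metric.tendsto_atTop]
  intro ε hε
  have huc := (isCompact_Icc (a := (0 : ℝ)) (b := T)).uniformContinuousOn_of_continuous
    hF.continuousOn
  obtain ⟨δ, hδ, huc⟩ := Metric.uniformContinuousOn_iff.1 huc (ε / (2 * T)) (by positivity)
  obtain ⟨M, hM⟩ := exists_nat_gt (T / δ)
  refine ⟨M, fun n hn => ?_⟩
  set N : ℝ := (n : ℝ) + 1 with hN
  have hN0 : 0 < N := by positivity
  have hMN : (M : ℝ) < N := by
    have : (M : ℝ) ≤ n := by exact_mod_cast hn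
    linarith
  have hstep : T / N < δ := by
    rw [div_lt_iff₀ hN0]
    rw [div_lt_iff₀ hδ] at hM
    nlinarith
  set t : ℕ → ℝ := fun i => T * i / N with ht
  have hts : ∀ i, t (i + 1) = t i + T / N := fun i => by simp only [ht]; push_cast; ring
  have hsum : ∑ i ∈ Finset.range (n + 1), ∫ x in t i..t (i + 1), F x = ∫ x in (0 : ℝ)..T, F x := by
    rw [intervalIntegral.sum_integral_adjacent_intervals fun i _ => hF.intervalIntegrable _ _]
    have h1 : t 0 = 0 := by simp [ht]
    have h2 : t (n + 1) = T := by simp only [ht, hN]; push_cast; field_simp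
    rw [h1, h2]
  have hterm : ∀ i ∈ Finset.range (n + 1),
      |T / N * F (t i) - ∫ x in t i..t (i + 1), F x| ≤ ε / (2 * T) * (T / N) := fun i hi => by
    have h1 : T / N * F (t i) - ∫ x in t i..t (i + 1), F x =
        ∫ x in t i..t (i + 1), (F (t i) - F x) := by
      rw [intervalIntegral.integral_sub (by simp) (hF.intervalIntegrable _ _),
        intervalIntegral.integral_const, hts]
      simp
    have hTN : 0 < T / N := by positivity
    have h0 : 0 ≤ t i := by positivity
    have hi1 : t (i + 1) ≤ T := by
      simp only [ht]
      rw [div_le_iff₀ hN0, hN]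
      have : ((i + 1 : ℕ) : ℝ) ≤ n + 1 := by exact_mod_cast Finset.mem_range.1 hi
      gcongr
    rw [h1, ← Real.norm_eq_abs]
    refine (intervalIntegral.norm_integral_le_of_norm_le_const (C := ε / (2 * T))
      fun x hx => ?_).trans_eq ?_
    · rw [Set.uIoc_of_le (by rw [hts]; linarith)] at hx
      rw [hts] at hx hi1
      refine (huc (t i) ⟨h0, by linarith⟩ x ⟨by linarith [hx.1], by linarith [hx.2]⟩ ?_).le
      rw [Real.dist_eq, abs_sub_comm, abs_of_pos (by linarith [hx.1])]
      linarith [hx.2]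
    · rw [hts, add_sub_cancel_left, abs_of_pos hTN]
  rw [Real.dist_eq, ← hsum, Finset.mul_sum, ← Finset.sum_sub_distrib]
  calc |∑ i ∈ Finset.range (n + 1), (T / N * F (t i) - ∫ x in t i..t (i + 1), F x)|
      ≤ ∑ i ∈ Finset.range (n + 1), ε / (2 * T) * (T / N) :=
        (Finset.abs_sum_le_sum_abs _ _).trans (Finset.sum_le_sum hterm)
    _ = ε / 2 := by
        rw [Finset.sum_const, Finset.card_range, nsmul_eq_mul, hN]
        push_cast
        field_simp
    _ < ε := by linarith

/-! ### From almost sure to mean square convergence, and limits of exponential moments. -/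

variable {Ω : Type*} [MeasurableSpace Ω] {P : Measure Ω}

/-- A sequence bounded in `L⁴` is uniformly integrable in `L²`. -/
lemma unifIntegrable_of_eLpNorm_four_le {f : ℕ → Ω → ℝ} (hf : ∀ n, AEStronglyMeasurable (f n) P)
    {C : ℝ≥0∞} (hC : C ≠ ∞) (h : ∀ n, eLpNorm (f n) 4 P ≤ C) : UnifIntegrable f 2 P := by
  intro ε hε
  -- The `+ 1` only makes `K` positive, so that `ε / K` makes sense when `C = 0`.
  set K : ℝ := C.toReal + 1 with hK
  have hK0 : 0 < K := by positivity
  -- Hölder's inequality from `L²` to `L⁴` costs the measure of `s` to the power `1/2 - 1/4`, whence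
  -- the fourth power.
  refine ⟨(ε / K) ^ 4, by positivity, fun n s hs hPs => ?_⟩
  rw [eLpNorm_indicator_eq_eLpNorm_restrict hs]
  refine (eLpNorm_le_eLpNorm_mul_rpow_measure_univ (p := 2) (q := 4) (by norm_num)
    (hf n).restrict).trans ?_
  have h1 : eLpNorm (f n) 4 (P.restrict s) ≤ ENNReal.ofReal K := by
    refine (eLpNorm_restrict_le _ _ _ _).trans ((h n).trans ?_)
    rw [ENNReal.le_ofReal_iff_toReal_le hC hK0.le]
    linarith
  have h2 : (P.restrict s) Set.univ ^ (1 / (2 : ℝ≥0∞).toReal - 1 / (4 : ℝ≥0∞).toReal) ≤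
      ENNReal.ofReal (ε / K) := by
    have e : 1 / (2 : ℝ≥0∞).toReal - 1 / (4 : ℝ≥0∞).toReal = 1 / 4 := by
      rw [ENNReal.toReal_ofNat, ENNReal.toReal_ofNat]; norm_num
    rw [Measure.restrict_apply_univ, e]
    refine (ENNReal.rpow_le_rpow hPs (by norm_num)).trans_eq ?_
    rw [ENNReal.ofReal_rpow_of_pos (by positivity), ← Real.rpow_natCast, ← Real.rpow_mul (by positivity)]
    norm_num
  calc _ ≤ ENNReal.ofReal K * ENNReal.ofReal (ε / K) := mul_le_mul' h1 h2
    _ = ENNReal.ofReal ε := by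
      rw [← ENNReal.ofReal_mul hK0.le]; congr 1; field_simp

section Limit

variable [IsProbabilityMeasure P]

/-- An almost sure limit of an `L⁴`-bounded sequence is a limit in `L²`. -/
lemma tendsto_L2_of_ae_of_eLpNorm_four_le {f : ℕ → Ω → ℝ} {g : Ω → ℝ}
    (hf : ∀ n, AEStronglyMeasurable (f n) P) {C : ℝ≥0∞} (hC : C ≠ ∞)
    (h : ∀ n, eLpNorm (f n) 4 P ≤ C) (hfg : ∀ᵐ ω ∂P, Tendsto (fun n => f n ω) atTop (𝓝 (g ω))) :
    MemLp g 2 P ∧ Tendsto (fun n => eLpNorm (fun ω => f n ω - g ω) 2 P) atTop (𝓝 0) := by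
  have hg : MemLp g 2 P := by
    refine ⟨aestronglyMeasurable_of_tendsto_ae atTop hf hfg, ?_⟩
    refine (Lp.eLpNorm_lim_le_liminf_eLpNorm hf g hfg).trans_lt ?_
    have : ∀ n, eLpNorm (f n) 2 P ≤ C := fun n =>
      (eLpNorm_le_eLpNorm_of_exponent_le (by norm_num) (hf n)).trans (h n)
    exact (liminf_le_of_le (by isBoundedDefault) fun b hb =>
      (hb.exists.choose_spec.trans (this _))).trans_lt hC.lt_top
  exact ⟨hg, tendsto_Lp_finite_of_tendsto_ae (by norm_num) (by norm_num) hf hg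
    (unifIntegrable_of_eLpNorm_four_le hf hC h) hfg⟩

/-- Bounds on exponential moments in terms of the variance pass to limits. -/
lemma exp_moment_le_of_tendsto {f : ℕ → Ω → ℝ} {g : Ω → ℝ} (hf : ∀ n, MemLp (f n) 2 P)
    (hg : MemLp g 2 P) (h2 : Tendsto (fun n => eLpNorm (fun ω => f n ω - g ω) 2 P) atTop (𝓝 0))
    (hfg : ∀ᵐ ω ∂P, Tendsto (fun n => f n ω) atTop (𝓝 (g ω))) {u : ℝ}
    (hmgf : ∀ n, √2 * |u| * √(Var[f n; P]) < 1 →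
      ∫⁻ ω, ENNReal.ofReal (Real.exp (u * (f n ω - P[f n]))) ∂P ≤
        ENNReal.ofReal (chaosBound (√2 * |u| * √(Var[f n; P]))))
    (hu : √2 * |u| * √(Var[g; P]) < 1) :
    ∫⁻ ω, ENNReal.ofReal (Real.exp (u * (g ω - P[g]))) ∂P ≤
      ENNReal.ofReal (chaosBound (√2 * |u| * √(Var[g; P]))) := by
  have hE := tendsto_integral_of_L2 hf hg h2
  have hV := tendsto_variance_of_L2 hf hg h2
  have hs : Tendsto (fun n => √2 * |u| * √(Var[f n; P])) atTop (𝓝 (√2 * |u| * √(Var[g; P]))) :=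
    (hV.sqrt).const_mul _
  have hB := ENNReal.tendsto_ofReal ((continuousAt_chaosBound hu).tendsto.comp hs)
  calc ∫⁻ ω, ENNReal.ofReal (Real.exp (u * (g ω - P[g]))) ∂P
      = ∫⁻ ω, liminf (fun n => ENNReal.ofReal (Real.exp (u * (f n ω - P[f n])))) atTop ∂P := by
        refine lintegral_congr_ae ?_
        filter_upwards [hfg] with ω hω
        refine (Tendsto.liminf_eq ?_).symm
        refine ENNReal.tendsto_ofReal ((Real.continuous_exp.tendsto _).comp ?_)
        exact (hω.sub hE).const_mul u
    _ ≤ liminf (fun n => ∫⁻ ω, ENNReal.ofReal (Real.exp (u * (f n ω - P[f n]))) ∂P) atTop := by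
        refine lintegral_liminf_le' fun n => ?_
        have := (hf n).1.aemeasurable
        fun_prop
    _ ≤ liminf (fun n => ENNReal.ofReal (chaosBound (√2 * |u| * √(Var[f n; P])))) atTop := by
        refine liminf_le_liminf ?_
        -- The condition on `u` is strict, so it holds for the approximants from some index on,
        -- which is enough for the lower limit.
        filter_upwards [hs.eventually (gt_mem_nhds hu)] with n hn using hmgf n hn
    _ = ENNReal.ofReal (chaosBound (√2 * |u| * √(Var[g; P]))) := hB.liminf_eq

end Limit

/-! ### The correlogram as a limit of Gaussian quadratic forms. -/

section Estimator

variable {W : ℝ → Ω → ℝ} {h k : ℝ → ℝ} {Y X : ℝ → Ω → ℝ}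

/-- The Riemann sums of the integral that defines the sample cross-correlogram. -/
def estimatorSum (c T : ℝ) (Y X : ℝ → Ω → ℝ) (τ : ℝ) (n : ℕ) (ω : Ω) : ℝ :=
  1 / (c * T) * (T / (n + 1) *
    ∑ i ∈ Finset.range (n + 1), Y (T * i / (n + 1) + τ) ω * X (T * i / (n + 1)) ω)

lemma tendsto_estimatorSum (hY : IsOutput W P h Y) (hX : IsOutput W P k X) (c : ℝ) {T : ℝ}
    (hT : 0 < T) (τ : ℝ) :
    ∀ᵐ ω ∂P, Tendsto (fun n => estimatorSum c T Y X τ n ω) atTop (𝓝 (estimator c T Y X τ ω)) := by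
  filter_upwards [hY.cont, hX.cont] with ω h1 h2
  exact (tendsto_riemannSum (F := fun t => Y (t + τ) ω * X t ω)
    ((h1.comp (continuous_add_const τ)).mul h2) hT).const_mul _

lemma aestronglyMeasurable_estimatorSum (hY : IsOutput W P h Y) (hX : IsOutput W P k X)
    (c T τ : ℝ) (n : ℕ) : AEStronglyMeasurable (estimatorSum c T Y X τ n) P :=
  ((Finset.aestronglyMeasurable_fun_sum _ fun _ _ =>
    (hY.integral _).1.mul (hX.integral _).1).const_mul _).const_mul _

variable [IsProbabilityMeasure P]

/-- By stationarity the eighth moments of `Y t` and `X t` do not depend on `t`, so Hölder's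
inequality with `1/8 + 1/8 = 1/4` bounds all products alike. The weights `T / (n + 1)` sum to `T`,
whatever `n` is. -/
lemma exists_eLpNorm_estimatorSum_le (hW : IsWienerProcess W P) (hh : MemLp h 2 volume)
    (hk : MemLp k 2 volume) (hY : IsOutput W P h Y) (hX : IsOutput W P k X) (c T τ : ℝ) :
    ∃ C : ℝ≥0∞, C ≠ ∞ ∧ ∀ n, eLpNorm (estimatorSum c T Y X τ n) 4 P ≤ C := by
  have : ENNReal.HolderTriple 8 8 4 := ⟨by
    rw [← two_mul, show (8 : ℝ≥0∞) = 2 * 4 by norm_num, ENNReal.mul_inv (by simp) (by simp),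
      ← mul_assoc, ENNReal.mul_inv_cancel (by simp) (by simp), one_mul]⟩
  have key : ∀ {l : ℝ → ℝ} {Z : ℝ → Ω → ℝ}, MemLp l 2 volume → IsOutput W P l Z → ∀ t,
      eLpNorm (Z t) 8 P = eLpNorm id 8 (gaussianReal 0 (∫ s, l s ^ 2).toNNReal) :=
    fun {l Z} hl hZ t => by
      rw [← hZ.map_eq hW hl t, eLpNorm_map_measure aestronglyMeasurable_id
        (hZ.integral t).1.aemeasurable, Function.id_comp]
  set B : ℝ≥0∞ := eLpNorm id 8 (gaussianReal 0 (∫ s, h s ^ 2).toNNReal) *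
    eLpNorm id 8 (gaussianReal 0 (∫ s, k s ^ 2).toNNReal) with hB
  have hB' : B ≠ ∞ := ENNReal.mul_ne_top (memLp_id_gaussianReal' 8 (by simp)).2.ne
    (memLp_id_gaussianReal' 8 (by simp)).2.ne
  refine ⟨‖1 / (c * T)‖ₑ * (‖T‖ₑ * B), by finiteness, fun n => ?_⟩
  have hprod : ∀ s t, eLpNorm (fun ω => Y s ω * X t ω) 4 P ≤ B := fun s t => by
    rw [hB, ← key hh hY s, ← key hk hX t]
    exact eLpNorm_smul_le_mul_eLpNorm (p := 8) (q := 8) (r := 4) (f := X t) (φ := Y s)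
      (hX.integral t).1 (hY.integral s).1
  have e : estimatorSum c T Y X τ n = (1 / (c * T)) • (T / (n + 1)) •
      ∑ i ∈ Finset.range (n + 1), fun ω => Y (T * i / (n + 1) + τ) ω * X (T * i / (n + 1)) ω := by
    ext ω
    simp [estimatorSum]
  rw [e, eLpNorm_const_smul, eLpNorm_const_smul]
  refine mul_le_mul' le_rfl ?_
  calc ‖T / ((n : ℝ) + 1)‖ₑ * eLpNorm (∑ i ∈ Finset.range (n + 1), fun ω =>
        Y (T * i / (n + 1) + τ) ω * X (T * i / (n + 1)) ω) 4 P
      ≤ ‖T / ((n : ℝ) + 1)‖ₑ * ((n + 1 : ℕ) * B) := by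
        gcongr
        refine (eLpNorm_sum_le (fun _ _ => (hY.integral _).1.mul (hX.integral _).1)
          (by norm_num)).trans ?_
        refine (Finset.sum_le_sum fun i _ => hprod _ _).trans_eq ?_
        simp
    _ = ‖T‖ₑ * B := by
        have : ((n + 1 : ℕ) : ℝ≥0∞) = ‖((n : ℝ) + 1)‖ₑ := by
          rw [← Nat.cast_succ, Real.enorm_natCast]
        rw [this, ← mul_assoc, ← enorm_mul, div_mul_cancel₀ _ (by positivity)]

open Matrix in
lemma exp_moment_estimatorSum_le (hW : IsWienerProcess W P) (hY : IsOutput W P h Y)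
    (hX : IsOutput W P k X) (c T τ : ℝ) (n : ℕ) {u : ℝ}
    (hu : √2 * |u| * √(Var[estimatorSum c T Y X τ n; P]) < 1) :
    ∫⁻ ω, ENNReal.ofReal (Real.exp (u *
        (estimatorSum c T Y X τ n ω - P[estimatorSum c T Y X τ n]))) ∂P ≤
      ENNReal.ofReal (chaosBound (√2 * |u| * √(Var[estimatorSum c T Y X τ n; P]))) := by
  let V : Fin (n + 1) ⊕ Fin (n + 1) → Ω → ℝ := Sum.elim
    (fun i => Y (T * (i : ℕ) / (n + 1) + τ)) (fun i => X (T * (i : ℕ) / (n + 1)))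
  let f : Fin (n + 1) ⊕ Fin (n + 1) → ℝ → ℝ := Sum.elim
    (fun i s => h (T * (i : ℕ) / (n + 1) + τ - s)) (fun i s => k (T * (i : ℕ) / (n + 1) - s))
  have hV : ∀ i, IsWienerIntegral W P (f i) (V i) := by
    rintro (i | i)
    · exact hY.integral _
    · exact hX.integral _
  refine mgf_quadraticForm_le (hasGaussianLaw_wienerIntegrals hW hV)
    (fun i => (hV i).integral_eq_zero hW)
    -- On the stacked vector of `Y` and `X` values, a single off-diagonal scalar block produces the
    -- weighted sum of products; the matrix need not be symmetric.
    (fromBlocks 0 ((1 / (c * T) * (T / (n + 1))) • (1 : Matrix (Fin (n + 1)) (Fin (n + 1)) ℝ)) 0 0)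
    (fun ω => ?_) hu
  have e : (fun i => V i ω) = Sum.elim (fun i : Fin (n + 1) => Y (T * (i : ℕ) / (n + 1) + τ) ω)
      (fun i : Fin (n + 1) => X (T * (i : ℕ) / (n + 1)) ω) := by
    ext (i | i) <;> rfl
  rw [e, fromBlocks_mulVec, sumElim_dotProduct_sumElim]
  simp only [Sum.elim_comp_inl, Sum.elim_comp_inr, zero_mulVec, zero_add, add_zero,
    dotProduct_zero, smul_mulVec, one_mulVec, dotProduct_smul, smul_eq_mul]
  rw [estimatorSum, Finset.sum_range]
  simp only [dotProduct]
  ring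

lemma estimator_bounds (hW : IsWienerProcess W P) (hh : MemLp h 2 volume)
    (hk : MemLp k 2 volume) (hY : IsOutput W P h Y) (hX : IsOutput W P k X) (c : ℝ) {T : ℝ}
    (hT : 0 < T) (τ : ℝ) :
    MemLp (estimator c T Y X τ) 2 P ∧ ∀ u : ℝ, √2 * |u| * √(Var[estimator c T Y X τ; P]) < 1 →
      ∫⁻ ω, ENNReal.ofReal (Real.exp (u *
          (estimator c T Y X τ ω - P[estimator c T Y X τ]))) ∂P ≤
        ENNReal.ofReal (chaosBound (√2 * |u| * √(Var[estimator c T Y X τ; P]))) := by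
  obtain ⟨C, hC, hle⟩ := exists_eLpNorm_estimatorSum_le hW hh hk hY hX c T τ
  have hm := aestronglyMeasurable_estimatorSum hY hX c T τ
  have hlim := tendsto_estimatorSum hY hX c hT τ
  obtain ⟨hg, h2⟩ := tendsto_L2_of_ae_of_eLpNorm_four_le hm hC hle hlim
  have hf : ∀ n, MemLp (estimatorSum c T Y X τ n) 2 P := fun n =>
    ⟨hm n, ((eLpNorm_le_eLpNorm_of_exponent_le (by norm_num) (hm n)).trans (hle n)).trans_lt
      hC.lt_top⟩
  exact ⟨hg, fun u hu => exp_moment_le_of_tendsto hf hg h2 hlim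
    (fun n hn => exp_moment_estimatorSum_le hW hY hX c T τ n hn) hu⟩

end Estimator

/-! ### Chernoff's inequality and the constant `K`. -/

section Tail

variable [IsProbabilityMeasure P]

lemma exp_mul_chaosBound_eq_K {x : ℝ} (hx : 0 < x) :
    Real.exp (-(x ^ 2 / (1 + √2 * x))) * chaosBound (√2 * x / (1 + √2 * x)) = K x := by
  have h2 : (0 : ℝ) < √2 := by positivity
  have h22 : √2 * √2 = 2 := Real.mul_self_sqrt (by norm_num)
  have hd : 0 < 1 + √2 * x := by positivity
  have h1 : 1 - √2 * x / (1 + √2 * x) = (1 + √2 * x)⁻¹ := by field_simp; ring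
  rw [← inv_sqrt_mul_exp (by rw [div_lt_one hd]; linarith), h1, Real.sqrt_inv, inv_inv, K,
    mul_left_comm, ← Real.exp_add]
  congr 2
  have h2' : √2 = 2 / √2 := by rw [eq_div_iff h2.ne', h22]
  rw [← sub_eq_zero]
  field_simp
  nlinarith

/-- The upper tail of a variable whose exponential moments are dominated by those of a centred
chi-square variable with the same variance. -/
lemma measure_ge_le_K {Z : Ω → ℝ} (hZ : MemLp Z 2 P) (hvar : 0 < Var[Z; P])
    (hmgf : ∀ u : ℝ, √2 * |u| * √(Var[Z; P]) < 1 →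
      ∫⁻ ω, ENNReal.ofReal (Real.exp (u * (Z ω - P[Z]))) ∂P ≤
        ENNReal.ofReal (chaosBound (√2 * |u| * √(Var[Z; P])))) {x : ℝ} (hx : 0 < x) {δ : ℝ}
    (hδ : |δ| = 1) :
    P.real {ω | x * √(Var[Z; P]) ≤ δ * (Z ω - P[Z])} ≤ K x := by
  set σ := √(Var[Z; P]) with hσ
  have hσ0 : 0 < σ := Real.sqrt_pos.2 hvar
  have hd : 0 < 1 + √2 * x := by positivity
  -- With `s = √2 * v * σ`, the Chernoff exponent `-x * s / √2 - (log (1 - s) + s) / 2` is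
  -- stationary when `s / (1 - s) = √2 * x`, that is, at this `v`.
  set v : ℝ := x / (σ * (1 + √2 * x)) with hv
  have hv0 : 0 < v := by positivity
  have hs : √2 * |v * δ| * σ = √2 * x / (1 + √2 * x) := by
    rw [abs_mul, hδ, abs_of_pos hv0, hv]
    field_simp
  have hm := hmgf (v * δ) (by rw [hs, div_lt_one hd]; linarith)
  rw [hs] at hm
  simp only [mul_assoc] at hm
  have hZm := hZ.1.aemeasurable
  have hint : Integrable (fun ω => Real.exp (v * (δ * (Z ω - P[Z])))) P := by
    refine ⟨by fun_prop, ?_⟩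
    rw [hasFiniteIntegral_iff_ofReal (ae_of_all _ fun _ => (Real.exp_pos _).le)]
    exact hm.trans_lt ENNReal.ofReal_lt_top
  rw [← ofReal_integral_eq_lintegral_ofReal hint (ae_of_all _ fun _ => (Real.exp_pos _).le),
    ENNReal.ofReal_le_ofReal_iff (chaosBound_nonneg _)] at hm
  refine (measure_ge_le_exp_mul_mgf (X := fun ω => δ * (Z ω - P[Z])) (x * σ) hv0.le hint).trans ?_
  rw [← exp_mul_chaosBound_eq_K hx]
  have : -v * (x * σ) = -(x ^ 2 / (1 + √2 * x)) := by rw [hv]; field_simp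
  rw [this]
  gcongr
  exact hm

end Tail

end SIDO

end

theorem theorem3 {Ω : Type*} [MeasurableSpace Ω] (P : Measure Ω) [IsProbabilityMeasure P]
    (W : ℝ → Ω → ℝ) (hW : SIDO.IsWienerProcess W P)
    (H : ℝ → ℝ) (hH : MemLp H 2 volume)
    (g : ℝ → ℝ → ℝ) (c : ℝ) (hg : SIDO.IsDeltaFamily g c)
    (Y : ℝ → Ω → ℝ) (hY : SIDO.IsOutput W P H Y)
    (X : ℝ → ℝ → Ω → ℝ) (hX : ∀ Δ : ℝ, 0 < Δ → SIDO.IsOutput W P (g Δ) (X Δ))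
    (T Δ : ℝ) (hT : 0 < T) (hΔ : 0 < Δ) (τ : ℝ) :
    MemLp (SIDO.estimator c T Y (X Δ) τ) 2 P ∧
    (0 < Var[SIDO.estimator c T Y (X Δ) τ; P] → ∀ x : ℝ, 0 < x →
      P.real {ω | SIDO.estimator c T Y (X Δ) τ ω - P[SIDO.estimator c T Y (X Δ) τ]
          ≥ x * √(Var[SIDO.estimator c T Y (X Δ) τ; P])} ≤ SIDO.K x ∧
      P.real {ω | SIDO.estimator c T Y (X Δ) τ ω - P[SIDO.estimator c T Y (X Δ) τ]
          ≤ -x * √(Var[SIDO.estimator c T Y (X Δ) τ; P])} ≤ SIDO.K x ∧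
      P.real {ω | |SIDO.estimator c T Y (X Δ) τ ω - P[SIDO.estimator c T Y (X Δ) τ]|
          ≥ x * √(Var[SIDO.estimator c T Y (X Δ) τ; P])} ≤ 2 * SIDO.K x) := by
  obtain ⟨hL, hmgf⟩ := SIDO.estimator_bounds hW hH (hg.memLp Δ hΔ) hY (hX Δ hΔ) c hT τ
  refine ⟨hL, fun hvar x hx => ?_⟩
  -- The exponential bound involves only `|u|`, so both signs of the deviation obey the same
  -- estimate.
  have hup := SIDO.measure_ge_le_K hL hvar hmgf hx (δ := 1) (by simp)
  have hlow := SIDO.measure_ge_le_K hL hvar hmgf hx (δ := -1) (by simp)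
  refine ⟨?_, ?_, ?_⟩
  · simpa only [one_mul] using hup
  · refine le_of_eq_of_le ?_ hlow
    congr 1
    ext ω
    simp only [Set.mem_ofPred_eq]
    constructor <;> intro h <;> linarith
  · rw [two_mul]
    refine le_trans ?_ (add_le_add hup hlow)
    refine (measureReal_mono fun ω hω => ?_).trans (measureReal_union_le _ _)
    simp only [Set.mem_ofPred_eq, ge_iff_le, le_abs] at hω
    rcases hω with h | h
    · exact Or.inl (by simpa using h)
    · exact Or.inr (by simpa using h)
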